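/- For non-empty sets $X,Y$ let $P(X,Y)$ be the set of all partial functions from $X$ to $Y$, with three binary operations: $f\circ g$ is the restriction of $g$ to $\mathrm{dom}(f)\cap\mathrm{dom}(g)$; $f\sqcup g$ agrees with $f$ on $\mathrm{dom}(f)$, with $g$ on $\mathrm{dom}(g)\setminus\mathrm{dom}(f)$, and is undefined elsewhere; $f-g$ is the restriction of $f$ to $\mathrm{dom}(f)\setminus\mathrm{dom}(g)$. An algebra of partial functions of signature $(\circ,\sqcup,-)$ is a subset of some $P(X,Y)$ closed under these three operations. Let $A$ be a non-empty set with three binary operations $\circ,\sqcup,-$. Then $(A,\circ,\sqcup,-)$ is isomorphic to an algebra of partial functions of signature $(\circ,\sqcup,-)$ if and only if $(A,\circ,\sqcup)$ is a right-handed strongly distributive skew lattice and there is an element $0\in A$ such that for all $x,y\in A$ $$0\circ x=0,\qquad (x-y)\circ y=0,\qquad (y\circ x)\sqcup(x-y)=x.$$ Here $(A,\circ,\sqcup)$ is called a right-handed strongly distributive skew lattice if $\circ$ and $\sqcup$ are associative and idempotent and, for all $x,y,z\in A$, $(x\circ y)\circ z=(y\circ x)\circ z$; $x\circ(x\sqcup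 y)=x=(y\sqcup x)\circ x$; $x\sqcup(x\circ y)=x=(y\circ x)\sqcup x$; $x\circ(y\sqcup z)=(x\circ y)\sqcup(x\circ z)$; and $(x\sqcup y)\circ z=(x\circ z)\sqcup(y\circ z)$. -/

import Mathlib

universe u v

/-- The similarity type with three binary operations: domain restriction, override, minus.
No laws are assumed. -/
class RestrictOverrideMinus (A : Type u) where
  restrict : A → A → A
  override : A → A → A
  minus : A → A → A

infixl:70 " ⊙ " => RestrictOverrideMinus.restrict
infixl:65 " ⊔ₒ " => RestrictOverrideMinus.override
infixl:65 " ⊖ₒ " => RestrictOverrideMinus.minus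

open Classical in
/-- The concrete operations on the set of all partial functions from `X` to `Y`:
`f ⊙ g` is `g` restricted to the domain of `f`;
`f ⊔ₒ g` is `f` on the domain of `f`, and `g` elsewhere;
`f ⊖ₒ g` is `f` restricted to the complement of the domain of `g`. -/
noncomputable instance PFun.instRestrictOverrideMinus (X : Type u) (Y : Type v) :
    RestrictOverrideMinus (X →. Y) where
  restrict f g := fun x => if (f x).Dom then g x else Part.none
  override f g := fun x => if (f x).Dom then f x else g x
  minus f g := fun x => if (g x).Dom then Part.none else f x

/-- A set of partial functions closed under the three operations. -/
structure IsAlgebraOfPartialFunctions {X : Type u} {Y : Type v} (S : Set (X →. Y)) : Prop where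
  restrict_mem : ∀ f ∈ S, ∀ g ∈ S, f ⊙ g ∈ S
  override_mem : ∀ f ∈ S, ∀ g ∈ S, f ⊔ₒ g ∈ S
  minus_mem : ∀ f ∈ S, ∀ g ∈ S, f ⊖ₒ g ∈ S

/-- The abstract algebra `A` is isomorphic to an algebra of partial functions: there is a bijection
from `A` onto a closed set of partial functions which preserves the three operations. -/
def IsIsomorphicToAlgebraOfPartialFunctions (A : Type u) [RestrictOverrideMinus A] : Prop :=
  ∃ (X Y : Type u) (_ : Nonempty X) (_ : Nonempty Y) (S : Set (X →. Y)),
    IsAlgebraOfPartialFunctions S ∧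
    ∃ φ : A ≃ S, ∀ a b : A,
      (φ (a ⊙ b) : X →. Y) = (φ a : X →. Y) ⊙ (φ b : X →. Y) ∧
      (φ (a ⊔ₒ b) : X →. Y) = (φ a : X →. Y) ⊔ₒ (φ b : X →. Y) ∧
      (φ (a ⊖ₒ b) : X →. Y) = (φ a : X →. Y) ⊖ₒ (φ b : X →. Y)

/-- `(A, op)` is a band: an idempotent semigroup. -/
structure IsBand {A : Type u} (op : A → A → A) : Prop where
  assoc : ∀ x y z, op (op x y) z = op x (op y z)
  idem : ∀ x, op x x = x

/-- `(A, op)` is a right normal band. -/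
structure IsRightNormalBand {A : Type u} (op : A → A → A) : Prop extends IsBand op where
  right_normal : ∀ x y z, op (op x y) z = op (op y x) z

/-- The reduct `(A, ⊙, ⊔ₒ)` is a right-handed strongly distributive skew lattice. -/
structure IsRightHandedStronglyDistributiveSkewLattice (A : Type u) [RestrictOverrideMinus A] :
    Prop where
  restrict_band : IsRightNormalBand (fun x y : A => x ⊙ y)
  override_band : IsBand (fun x y : A => x ⊔ₒ y)
  restrict_absorb_left : ∀ x y : A, x ⊙ (x ⊔ₒ y) = x
  restrict_absorb_right : ∀ x y : A, (y ⊔ₒ x) ⊙ x = x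
  override_absorb_left : ∀ x y : A, x ⊔ₒ (x ⊙ y) = x
  override_absorb_right : ∀ x y : A, (y ⊙ x) ⊔ₒ x = x
  restrict_override : ∀ s t u : A, s ⊙ (t ⊔ₒ u) = (s ⊙ t) ⊔ₒ (s ⊙ u)
  override_restrict : ∀ s t u : A, (s ⊔ₒ t) ⊙ u = (s ⊙ u) ⊔ₒ (t ⊙ u)

/-! The laws hold pointwise for partial functions, with the empty function as zero, and pass to
subalgebras. Conversely, a point of a representation determines the prime ideal `J` of elements
undefined there. So take all prime ideals as points, and let `a` be defined at `J` when `a ∉ J`,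
with value its germ. Primality turns `⊙` into intersection of domains, and the zero laws make minus
a relative complement. For injectivity, the elements on whose domain `a ≠ b` agree form an ideal
missing `a` or `b`; Zorn's lemma enlarges it to a prime ideal still missing that element, where `a`
and `b` differ in domain or in germ. -/

namespace PFun

variable {X : Type u} {Y : Type v}

theorem restrict_apply (f g : X →. Y) (x : X) [Decidable (f x).Dom] :
    (f ⊙ g) x = if (f x).Dom then g x else Part.none := by
  simp only [RestrictOverrideMinus.restrict]; congr

theorem override_apply (f g : X →. Y) (x : X) [Decidable (f x).Dom] :
    (f ⊔ₒ g) x = if (f x).Dom then f x else g x := by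
  simp only [RestrictOverrideMinus.override]; congr

theorem minus_apply (f g : X →. Y) (x : X) [Decidable (g x).Dom] :
    (f ⊖ₒ g) x = if (g x).Dom then Part.none else f x := by
  simp only [RestrictOverrideMinus.minus]; congr

theorem isRightHandedStronglyDistributiveSkewLattice :
    IsRightHandedStronglyDistributiveSkewLattice (X →. Y) := by
  classical
  have hnone : ¬ (Part.none : Part Y).Dom := Part.not_none_dom
  constructor
  · refine ⟨⟨?_, ?_⟩, ?_⟩
    all_goals intros; funext p; simp only [restrict_apply]; grind [Part.eq_none_iff']
  · constructor
    all_goals intros; funext p; simp only [override_apply]; grind [Part.eq_none_iff']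
  all_goals
    intros; funext p; simp only [restrict_apply, override_apply]; grind [Part.eq_none_iff']

theorem minus_self_restrict (f g : X →. Y) : (f ⊖ₒ f) ⊙ g = f ⊖ₒ f := by
  classical
  have hnone : ¬ (Part.none : Part Y).Dom := Part.not_none_dom
  funext p; simp only [restrict_apply, minus_apply]; grind [Part.eq_none_iff']

/-- Every `h ⊖ₒ h` is the empty function, so any element of a non-empty algebra yields the zero. -/
theorem minus_restrict (f g h : X →. Y) : (f ⊖ₒ g) ⊙ g = h ⊖ₒ h := by
  classical
  have hnone : ¬ (Part.none : Part Y).Dom := Part.not_none_dom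
  funext p; simp only [restrict_apply, minus_apply]; grind [Part.eq_none_iff']

theorem restrict_override_minus (f g : X →. Y) : (g ⊙ f) ⊔ₒ (f ⊖ₒ g) = f := by
  classical
  have hnone : ¬ (Part.none : Part Y).Dom := Part.not_none_dom
  funext p; simp only [restrict_apply, override_apply, minus_apply]; grind [Part.eq_none_iff']

end PFun

/-- The laws of a right-handed strongly distributive skew lattice pass to algebras that embed. -/
theorem IsRightHandedStronglyDistributiveSkewLattice.of_injective {A : Type u} {B : Type v}
    [RestrictOverrideMinus A] [RestrictOverrideMinus B]
    (h : IsRightHandedStronglyDistributiveSkewLattice B) (f : A → B) (hf : Function.Injective f)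
    (hr : ∀ a b, f (a ⊙ b) = f a ⊙ f b) (ho : ∀ a b, f (a ⊔ₒ b) = f a ⊔ₒ f b) :
    IsRightHandedStronglyDistributiveSkewLattice A where
  restrict_band :=
    { assoc := fun x y z => hf (by simpa only [hr] using h.restrict_band.assoc _ _ _)
      idem := fun x => hf (by simpa only [hr] using h.restrict_band.idem _)
      right_normal := fun x y z =>
        hf (by simpa only [hr] using h.restrict_band.right_normal _ _ _) }
  override_band :=
    { assoc := fun x y z => hf (by simpa only [ho] using h.override_band.assoc _ _ _)
      idem := fun x => hf (by simpa only [ho] using h.override_band.idem _) }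
  restrict_absorb_left x y := hf (by simpa only [hr, ho] using h.restrict_absorb_left _ _)
  restrict_absorb_right x y := hf (by simpa only [hr, ho] using h.restrict_absorb_right _ _)
  override_absorb_left x y := hf (by simpa only [hr, ho] using h.override_absorb_left _ _)
  override_absorb_right x y := hf (by simpa only [hr, ho] using h.override_absorb_right _ _)
  restrict_override s t u := hf (by simpa only [hr, ho] using h.restrict_override _ _ _)
  override_restrict s t u := hf (by simpa only [hr, ho] using h.override_restrict _ _ _)

/-! ### Prime ideals and germs -/

namespace RestrictOverrideMinus

variable {A : Type u} [RestrictOverrideMinus A]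

/-- An ideal with respect to domain inclusion, containing the given element `zero`. -/
structure IsIdeal (zero : A) (J : Set A) : Prop where
  zero_mem : zero ∈ J
  restrict_mem : ∀ x ∈ J, ∀ y, x ⊙ y ∈ J
  override_mem : ∀ x ∈ J, ∀ y ∈ J, x ⊔ₒ y ∈ J

/-- A prime ideal; the improper ideal is allowed. -/
structure IsPrimeIdeal (zero : A) (J : Set A) : Prop extends IsIdeal zero J where
  mem_or_mem : ∀ x y, x ⊙ y ∈ J → x ∈ J ∨ y ∈ J

/-- The germ of `a` at `J`: all elements agreeing with `a` on some domain outside `J`. -/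
def germ (J : Set A) (a : A) : Set A := {c | ∃ d, d ∉ J ∧ d ⊙ c = d ⊙ a}

open Classical in
/-- The partial function on prime ideals which represents `a`. -/
noncomputable def representation (zero : A) (a : A) : {J : Set A // IsPrimeIdeal zero J} →. Set A :=
  fun J => if a ∈ J.1 then Part.none else Part.some (germ J.1 a)

theorem representation_of_mem {zero a : A} {J : {J : Set A // IsPrimeIdeal zero J}}
    (h : a ∈ J.1) : representation zero a J = Part.none := if_pos h

theorem representation_of_notMem {zero a : A} {J : {J : Set A // IsPrimeIdeal zero J}}
    (h : a ∉ J.1) : representation zero a J = Part.some (germ J.1 a) := if_neg h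

theorem representation_dom {zero a : A} {J : {J : Set A // IsPrimeIdeal zero J}} :
    (representation zero a J).Dom ↔ a ∉ J.1 := by
  by_cases h : a ∈ J.1
  · simp [representation_of_mem h, h]
  · simp [representation_of_notMem h, h]

end RestrictOverrideMinus

namespace IsRightHandedStronglyDistributiveSkewLattice

open RestrictOverrideMinus

variable {A : Type u} [RestrictOverrideMinus A] {zero : A} {J : Set A}

theorem restrict_assoc (hL : IsRightHandedStronglyDistributiveSkewLattice A) (x y z : A) :
    (x ⊙ y) ⊙ z = x ⊙ (y ⊙ z) := hL.restrict_band.assoc x y z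

theorem restrict_self (hL : IsRightHandedStronglyDistributiveSkewLattice A) (x : A) :
    x ⊙ x = x := hL.restrict_band.idem x

theorem restrict_right_comm (hL : IsRightHandedStronglyDistributiveSkewLattice A) (x y z : A) :
    (x ⊙ y) ⊙ z = (y ⊙ x) ⊙ z := hL.restrict_band.right_normal x y z

theorem restrict_restrict_self (hL : IsRightHandedStronglyDistributiveSkewLattice A) (x y : A) :
    (x ⊙ y) ⊙ x = y ⊙ x := by
  rw [hL.restrict_right_comm, hL.restrict_assoc, hL.restrict_self]

theorem zero_override (hL : IsRightHandedStronglyDistributiveSkewLattice A)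
    (h0 : ∀ x : A, zero ⊙ x = zero) (x : A) : zero ⊔ₒ x = x := by
  simpa only [h0] using hL.override_absorb_right x zero

/-- One-sided closure suffices because `y ⊙ x = (x ⊙ y) ⊙ x`. -/
theorem restrict_mem_right (hL : IsRightHandedStronglyDistributiveSkewLattice A)
    (hJ : IsIdeal zero J) {x : A} (hx : x ∈ J) (y : A) : y ⊙ x ∈ J := by
  rw [← hL.restrict_restrict_self]
  exact hJ.restrict_mem _ (hJ.restrict_mem _ hx _) _

theorem restrict_mem_iff (hL : IsRightHandedStronglyDistributiveSkewLattice A)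
    (hJ : IsPrimeIdeal zero J) {x y : A} : x ⊙ y ∈ J ↔ x ∈ J ∨ y ∈ J :=
  ⟨hJ.mem_or_mem x y, fun h => h.elim (fun h => hJ.restrict_mem _ h _)
    fun h => hL.restrict_mem_right hJ.toIsIdeal h _⟩

theorem override_mem_iff (hL : IsRightHandedStronglyDistributiveSkewLattice A)
    (hJ : IsIdeal zero J) {x y : A} : x ⊔ₒ y ∈ J ↔ x ∈ J ∧ y ∈ J := by
  refine ⟨fun h => ⟨?_, ?_⟩, fun h => hJ.override_mem _ h.1 _ h.2⟩
  · simpa only [hL.restrict_absorb_left] using hL.restrict_mem_right hJ h x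
  · simpa only [hL.restrict_absorb_right] using hJ.restrict_mem _ h y

/-- Primality keeps `d ⊙ e` outside `J`, so two witnesses of agreement combine; right normality lets
either factor act first. -/
theorem germ_eq_germ_iff (hL : IsRightHandedStronglyDistributiveSkewLattice A)
    (hJ : IsPrimeIdeal zero J) {a b : A} (ha : a ∉ J) :
    germ J a = germ J b ↔ ∃ d, d ∉ J ∧ d ⊙ a = d ⊙ b := by
  constructor
  · intro h
    have : a ∈ germ J a := ⟨a, ha, rfl⟩
    rwa [h] at this
  · rintro ⟨d, hd, hab⟩
    have key : ∀ e, e ∉ J → d ⊙ e ∉ J := fun e he h =>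
      (hJ.mem_or_mem _ _ h).elim hd he
    ext c
    constructor
    · rintro ⟨e, he, hc⟩
      refine ⟨d ⊙ e, key e he, ?_⟩
      rw [hL.restrict_assoc, hc, ← hL.restrict_assoc, hL.restrict_right_comm, hL.restrict_assoc,
        hab, ← hL.restrict_assoc, hL.restrict_right_comm]
    · rintro ⟨e, he, hc⟩
      refine ⟨d ⊙ e, key e he, ?_⟩
      rw [hL.restrict_assoc, hc, ← hL.restrict_assoc, hL.restrict_right_comm, hL.restrict_assoc,
        ← hab, ← hL.restrict_assoc, hL.restrict_right_comm]

/-- The quotient ideal `(J : c)`. -/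
theorem isIdeal_quotient (hL : IsRightHandedStronglyDistributiveSkewLattice A)
    (hJ : IsIdeal zero J) (c : A) : IsIdeal zero {x | c ⊙ x ∈ J} where
  zero_mem := hL.restrict_mem_right hJ hJ.zero_mem c
  restrict_mem x hx y := by
    change c ⊙ (x ⊙ y) ∈ J
    rw [← hL.restrict_assoc]
    exact hJ.restrict_mem _ hx _
  override_mem x hx y hy := by
    change c ⊙ (x ⊔ₒ y) ∈ J
    rw [hL.restrict_override]
    exact hJ.override_mem _ hx _ hy

/-- The elements on whose domain `a` and `b` agree form an ideal. -/
theorem isIdeal_equalizer (hL : IsRightHandedStronglyDistributiveSkewLattice A)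
    (h0 : ∀ x : A, zero ⊙ x = zero) (a b : A) : IsIdeal zero {c | c ⊙ a = c ⊙ b} where
  zero_mem := by simp only [Set.mem_ofPred_eq, h0]
  restrict_mem x hx y := by
    simp only [Set.mem_ofPred_eq] at hx ⊢
    rw [hL.restrict_right_comm, hL.restrict_assoc, hx, ← hL.restrict_assoc,
      hL.restrict_right_comm]
  override_mem x hx y hy := by
    simp only [Set.mem_ofPred_eq] at hx hy ⊢
    rw [hL.override_restrict, hL.override_restrict, hx, hy]

/-- Let `M` be maximal among ideals omitting `a`. If `c ⊙ d ∈ M` and `d ∉ M`, the quotient `(M : c)`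
properly contains `M`, so `c ⊙ a ∈ M` and hence `a ⊙ c ∈ M`. If also `c ∉ M`, the same argument for
`a ⊙ c` gives `a = a ⊙ a ∈ M`. -/
theorem exists_isPrimeIdeal (hL : IsRightHandedStronglyDistributiveSkewLattice A)
    (hJ : IsIdeal zero J) {a : A} (ha : a ∉ J) :
    ∃ M, IsPrimeIdeal zero M ∧ J ⊆ M ∧ a ∉ M := by
  obtain ⟨M, hJM, hM⟩ := zorn_subset_nonempty {K : Set A | IsIdeal zero K ∧ a ∉ K}
    (by
      rintro C hC hchain ⟨K, hK⟩
      refine ⟨⋃₀ C, ⟨⟨⟨K, hK, (hC hK).1.zero_mem⟩, ?_, ?_⟩, ?_⟩,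
        fun _ => Set.subset_sUnion_of_mem⟩
      · rintro x ⟨L, hLC, hx⟩ y
        exact ⟨L, hLC, (hC hLC).1.restrict_mem x hx y⟩
      · rintro x ⟨L, hLC, hx⟩ y ⟨N, hN, hy⟩
        rcases hchain.total hLC hN with h | h
        · exact ⟨N, hN, (hC hN).1.override_mem x (h hx) y hy⟩
        · exact ⟨L, hLC, (hC hLC).1.override_mem x hx y (h hy)⟩
      · rintro ⟨L, hLC, h⟩
        exact (hC hLC).2 h) J ⟨hJ, ha⟩
  have hMi : IsIdeal zero M := hM.prop.1
  have haM : a ∉ M := hM.prop.2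
  have quot : ∀ c d, c ⊙ d ∈ M → d ∉ M → c ⊙ a ∈ M := by
    intro c d hcd hd
    by_contra hca
    exact hd (hM.le_of_ge ⟨hL.isIdeal_quotient hMi c, hca⟩
      (fun x hx => hL.restrict_mem_right hMi hx c) hcd)
  refine ⟨M, ⟨hMi, fun c d hcd => ?_⟩, hJM, haM⟩
  by_contra! h
  have hac : a ⊙ c ∈ M := by
    rw [← hL.restrict_restrict_self]
    exact hMi.restrict_mem _ (quot c d hcd h.2) c
  exact haM (by simpa only [hL.restrict_self] using quot a c hac h.1)

theorem eq_of_restrict_eq (hL : IsRightHandedStronglyDistributiveSkewLattice A) {a b : A}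
    (ha : a ⊙ a = a ⊙ b) (hb : b ⊙ a = b ⊙ b) : a = b := by
  rw [hL.restrict_self] at ha hb
  have h := hL.restrict_restrict_self a b
  rwa [← ha, hL.restrict_self, hb] at h

theorem exists_isPrimeIdeal_of_ne (hL : IsRightHandedStronglyDistributiveSkewLattice A)
    (h0 : ∀ x : A, zero ⊙ x = zero) {a b : A} (hab : a ≠ b) :
    ∃ M, IsPrimeIdeal zero M ∧ (∀ c, c ⊙ a = c ⊙ b → c ∈ M) ∧ (a ∉ M ∨ b ∉ M) := by
  have hE := hL.isIdeal_equalizer h0 a b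
  by_cases ha : a ⊙ a = a ⊙ b
  · have hb : ¬ b ⊙ a = b ⊙ b := fun hb => hab (hL.eq_of_restrict_eq ha hb)
    obtain ⟨M, hM, hEM, h⟩ := hL.exists_isPrimeIdeal hE (a := b) hb
    exact ⟨M, hM, fun c hc => hEM hc, Or.inr h⟩
  · obtain ⟨M, hM, hEM, h⟩ := hL.exists_isPrimeIdeal hE (a := a) ha
    exact ⟨M, hM, fun c hc => hEM hc, Or.inl h⟩

/-! ### The representation is an embedding -/

theorem representation_injective (hL : IsRightHandedStronglyDistributiveSkewLattice A)
    (h0 : ∀ x : A, zero ⊙ x = zero) : Function.Injective (representation zero) := by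
  intro a b hab
  by_contra hne
  obtain ⟨M, hM, hE, h⟩ := hL.exists_isPrimeIdeal_of_ne h0 hne
  have hval := congrFun hab ⟨M, hM⟩
  have hdom : a ∉ M ↔ b ∉ M := by
    have := congrArg Part.Dom hval
    rwa [eq_iff_iff, representation_dom, representation_dom] at this
  have ha : a ∉ M := h.elim id hdom.2
  rw [representation_of_notMem ha, representation_of_notMem (hdom.1 ha), Part.some_inj,
    hL.germ_eq_germ_iff hM ha] at hval
  obtain ⟨d, hd, hdab⟩ := hval
  exact hd (hE d hdab)

theorem representation_restrict (hL : IsRightHandedStronglyDistributiveSkewLattice A) (a b : A) :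
    representation zero (a ⊙ b) = representation zero a ⊙ representation zero b := by
  classical
  funext J
  rw [PFun.restrict_apply]
  have hmem := hL.restrict_mem_iff J.2 (x := a) (y := b)
  by_cases ha : a ∈ J.1
  · rw [if_neg (by simpa [representation_dom] using ha),
      representation_of_mem (hmem.2 (Or.inl ha))]
  rw [if_pos (representation_dom.2 ha)]
  by_cases hb : b ∈ J.1
  · rw [representation_of_mem hb, representation_of_mem (hmem.2 (Or.inr hb))]
  have hab : a ⊙ b ∉ J.1 := fun h => (hmem.1 h).elim ha hb
  rw [representation_of_notMem hb, representation_of_notMem hab, Part.some_inj,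
    hL.germ_eq_germ_iff J.2 hab]
  exact ⟨a, ha, by rw [← hL.restrict_assoc, hL.restrict_self]⟩

theorem minus_notMem (hJ : IsIdeal zero J) (h2 : ∀ x y : A, (y ⊙ x) ⊔ₒ (x ⊖ₒ y) = x)
    {a b : A} (ha : a ∉ J) (hb : b ∈ J) : a ⊖ₒ b ∉ J := fun h =>
  ha (by simpa only [h2] using hJ.override_mem _ (hJ.restrict_mem _ hb a) _ h)

theorem representation_override (hL : IsRightHandedStronglyDistributiveSkewLattice A)
    (h0 : ∀ x : A, zero ⊙ x = zero) (h1 : ∀ x y : A, (x ⊖ₒ y) ⊙ y = zero)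
    (h2 : ∀ x y : A, (y ⊙ x) ⊔ₒ (x ⊖ₒ y) = x) (a b : A) :
    representation zero (a ⊔ₒ b) = representation zero a ⊔ₒ representation zero b := by
  classical
  funext J
  rw [PFun.override_apply]
  have hmem := hL.override_mem_iff J.2.toIsIdeal (x := a) (y := b)
  by_cases ha : a ∈ J.1
  · rw [if_neg (by simpa [representation_dom] using ha)]
    by_cases hb : b ∈ J.1
    · rw [representation_of_mem hb, representation_of_mem (hmem.2 ⟨ha, hb⟩)]
    have hab : a ⊔ₒ b ∉ J.1 := fun h => hb (hmem.1 h).2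
    rw [representation_of_notMem hb, representation_of_notMem hab, Part.some_inj,
      hL.germ_eq_germ_iff J.2 hab]
    -- On the domain of `b ⊖ₒ a` the term `a` restricts to `zero`, leaving only `b`.
    exact ⟨b ⊖ₒ a, minus_notMem J.2.toIsIdeal h2 hb ha, by
      rw [hL.restrict_override, h1, hL.zero_override h0]⟩
  · have hab : a ⊔ₒ b ∉ J.1 := fun h => ha (hmem.1 h).1
    rw [if_pos (representation_dom.2 ha), representation_of_notMem ha,
      representation_of_notMem hab, Part.some_inj, hL.germ_eq_germ_iff J.2 hab]
    exact ⟨a, ha, by rw [hL.restrict_absorb_left, hL.restrict_self]⟩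

theorem representation_minus (hL : IsRightHandedStronglyDistributiveSkewLattice A)
    (h0 : ∀ x : A, zero ⊙ x = zero) (h1 : ∀ x y : A, (x ⊖ₒ y) ⊙ y = zero)
    (h2 : ∀ x y : A, (y ⊙ x) ⊔ₒ (x ⊖ₒ y) = x) (a b : A) :
    representation zero (a ⊖ₒ b) = representation zero a ⊖ₒ representation zero b := by
  classical
  funext J
  rw [PFun.minus_apply]
  by_cases hb : b ∈ J.1
  · rw [if_neg (by simpa [representation_dom] using hb)]
    by_cases ha : a ∈ J.1
    · have hab : a ⊖ₒ b ∈ J.1 := by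
        -- Absorption in `a = (b ⊙ a) ⊔ₒ (a ⊖ₒ b)` gives `a ⊙ (a ⊖ₒ b) = a ⊖ₒ b`.
        have h := J.2.restrict_mem _ ha (a ⊖ₒ b)
        have e := hL.restrict_absorb_right (a ⊖ₒ b) (b ⊙ a)
        rw [h2] at e
        rwa [e] at h
      rw [representation_of_mem ha, representation_of_mem hab]
    have hab := minus_notMem J.2.toIsIdeal h2 ha hb
    rw [representation_of_notMem ha, representation_of_notMem hab, Part.some_inj,
      hL.germ_eq_germ_iff J.2 hab]
    refine ⟨a ⊖ₒ b, hab, ?_⟩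
    -- Restrict the same decomposition of `a` to the domain of `a ⊖ₒ b`: the part `b ⊙ a` vanishes.
    have e := hL.restrict_override (a ⊖ₒ b) (b ⊙ a) (a ⊖ₒ b)
    rw [h2, ← hL.restrict_assoc, h1, h0, hL.zero_override h0] at e
    exact e.symm
  · rw [if_pos (representation_dom.2 hb)]
    have hab : (a ⊖ₒ b) ⊙ b ∈ J.1 := by rw [h1]; exact J.2.zero_mem
    exact representation_of_mem ((J.2.mem_or_mem _ _ hab).resolve_right hb)

end IsRightHandedStronglyDistributiveSkewLattice

theorem proposition5p5 (A : Type u) [Nonempty A] [RestrictOverrideMinus A] :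
    IsIsomorphicToAlgebraOfPartialFunctions A ↔
      IsRightHandedStronglyDistributiveSkewLattice A ∧
      ∃ zero : A,
        (∀ x : A, zero ⊙ x = zero) ∧
        (∀ x y : A, (x ⊖ₒ y) ⊙ y = zero) ∧
        (∀ x y : A, (y ⊙ x) ⊔ₒ (x ⊖ₒ y) = x) := by
  constructor
  · rintro ⟨X, Y, -, -, S, -, φ, hφ⟩
    have hinj : Function.Injective fun a : A => (φ a : X →. Y) :=
      Subtype.val_injective.comp φ.injective
    refine ⟨PFun.isRightHandedStronglyDistributiveSkewLattice.of_injective _ hinj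
      (fun a b => (hφ a b).1) (fun a b => (hφ a b).2.1), ?_⟩
    obtain ⟨c⟩ := ‹Nonempty A›
    refine ⟨c ⊖ₒ c, fun x => hinj ?_, fun x y => hinj ?_, fun x y => hinj ?_⟩
    · simp only [(hφ _ _).1, (hφ _ _).2.2, PFun.minus_self_restrict]
    · simpa only [(hφ _ _).1, (hφ _ _).2.2] using PFun.minus_restrict _ _ _
    · simp only [(hφ _ _).1, (hφ _ _).2.1, (hφ _ _).2.2, PFun.restrict_override_minus]
  · rintro ⟨hL, zero, h0, h1, h2⟩
    open RestrictOverrideMinus in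
    refine ⟨{J : Set A // IsPrimeIdeal zero J}, Set A,
      -- The improper ideal, where nothing is defined, keeps the set of points non-empty even when
      -- `A` is just `zero`.
      ⟨Set.univ, ⟨⟨trivial, fun _ _ _ => trivial, fun _ _ _ _ => trivial⟩,
        fun _ _ _ => Or.inl trivial⟩⟩, inferInstance, Set.range (representation zero), ⟨?_, ?_, ?_⟩,
      Equiv.ofInjective _ (hL.representation_injective h0), fun a b =>
        ⟨hL.representation_restrict a b, hL.representation_override h0 h1 h2 a b,
          hL.representation_minus h0 h1 h2 a b⟩⟩
    · rintro _ ⟨a, rfl⟩ _ ⟨b, rfl⟩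
      exact ⟨a ⊙ b, hL.representation_restrict a b⟩
    · rintro _ ⟨a, rfl⟩ _ ⟨b, rfl⟩
      exact ⟨a ⊔ₒ b, hL.representation_override h0 h1 h2 a b⟩
    · rintro _ ⟨a, rfl⟩ _ ⟨b, rfl⟩
      exact ⟨a ⊖ₒ b, hL.representation_minus h0 h1 h2 a b⟩
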